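/- Let $p$ be a prime and let $\mathbb{T}=\{z\in\mathbb{C}:|z|=1\}$. The $p$-adic solenoid is the compact Abelian group $$S_p=\{(y_0,y_1,\dots)\in\mathbb{T}^{\infty}: y_j=y_{j+1}^{\,p}\ \text{for all } j\ge 0\}$$ with coordinatewise multiplication (written additively below, with identity $e$) and the topology induced by the product topology. For integers $d\ge 0$ and $\ell$ let $\chi_{d,\ell}(y)=y_d^{\ell}$ be the corresponding character of $S_p$. For $b\ge 0$ let $\psi_b(\chi_{d,\ell})=b\ell^2/p^{2d}$, and let $\gamma_{\psi_b}$ be the unique Borel probability measure on $S_p$ such that $$\int_{S_p}\chi_{d,\ell}\,\mathrm{d}\gamma_{\psi_b}=e^{-\psi_b(\chi_{d,\ell})/2}\qquad\text{for all integers } d\ge 0 \text{ and } \ell.$$ Let $\omega_{S_p}$ be the Haar measure on $S_p$ with $\omega_{S_p}(S_p)=1$. For $z\in\mathbb{T}$ let $\arg z$ be the principal argument of $z$, so that $|\arg z|\le\pi$ and $z=e^{i\arg z}$. Let $x^{(n)}\in S_p$, $n\in\mathbb{N}$, with $x^{(n)}\to e$, and let $K_n$ be natural numbers with $K_n\to\infty$.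 Let $\{X_{n,k}:n\in\mathbb{N},\ 1\le k\le K_n\}$ be an array of random elements in $S_p$ such that for each $n$ the elements $X_{n,1},\dots,X_{n,K_n}$ of the $n$-th row are defined on a common probability space, are independent, and each have the distribution $\tfrac12\delta_{x^{(n)}}+\tfrac12\delta_{-x^{(n)}}$, i.e. $X_{n,k}=\pm x^{(n)}$ with probability $\tfrac12$ each. Then: 1. The array is infinitesimal: $\max_{1\le k\le K_n}\mathrm{P}(X_{n,k}\in S_p\setminus U)\to 0$ as $n\to\infty$ for every Borel neighbourhood $U$ of $e$. 2. For every real $b\ge 0$, the row sums $\sum_{k=1}^{K_n}X_{n,k}$ converge in distribution to $\gamma_{\psi_b}$ as $n\to\infty$ if and only if $K_n\,(\arg x_0^{(n)})^2\to b$. 3. The row sums $\sum_{k=1}^{K_n}X_{n,k}$ converge in distribution to $\omega_{S_p}$ as $n\to\infty$ if and only if $K_n\,(\arg x_0^{(n)})^2\to\infty$. -/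

import Mathlib

open MeasureTheory ProbabilityTheory Filter Topology
open scoped NNReal ENNReal BoundedContinuousFunction

/-- The `p`-adic solenoid `S_p = {(y₀, y₁, …) ∈ 𝕋^∞ : y_j = y_{j+1} ^ p for all j}`, a subgroup
of the product group `𝕋^∞` (written multiplicatively), with the subspace topology of the product
topology. -/
def solenoid (p : ℕ) : Subgroup (ℕ → Circle) where
  carrier := {y | ∀ j, y j = y (j + 1) ^ p}
  mul_mem' := by
    intro a b ha hb j
    simp only [Pi.mul_apply]
    rw [ha j, hb j, mul_pow]
  one_mem' := by intro j; simp
  inv_mem' := by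
    intro a ha j
    simp only [Pi.inv_apply]
    rw [ha j, inv_pow]

namespace solenoid

/-- The solenoid carries its Borel `σ`-algebra. -/
noncomputable instance instMeasurableSpace (p : ℕ) : MeasurableSpace (solenoid p) := borel _

instance instBorelSpace (p : ℕ) : BorelSpace (solenoid p) := ⟨rfl⟩

theorem isClosed (p : ℕ) : IsClosed (solenoid p : Set (ℕ → Circle)) := by
  have h : (solenoid p : Set (ℕ → Circle)) = ⋂ j, {y | y j = y (j + 1) ^ p} := by
    ext y
    simp only [Set.mem_iInter, Set.mem_ofPred_eq]
    exact Iff.rfl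
  rw [h]
  exact isClosed_iInter fun j => isClosed_eq (by fun_prop) (by fun_prop)

instance instCompactSpace (p : ℕ) : CompactSpace (solenoid p) :=
  isCompact_iff_compactSpace.mp (isClosed p).isCompact

/-- The character `χ_{d,ℓ}(y) = y_d ^ ℓ` of the solenoid, `d ∈ ℤ₊`, `ℓ ∈ ℤ`. -/
noncomputable def chi (p d : ℕ) (l : ℤ) : PontryaginDual (solenoid p) :=
  ({ toFun := fun y => (y : ℕ → Circle) d ^ l
     map_one' := by simp
     map_mul' := fun a b => by simp [mul_zpow]
     continuous_toFun :=
       ((continuous_apply d).comp continuous_subtype_val).zpow l } : solenoid p →ₜ* Circle)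

@[simp] theorem chi_apply (p d : ℕ) (l : ℤ) (y : solenoid p) :
    chi p d l y = (y : ℕ → Circle) d ^ l := rfl

/-- The quadratic form `ψ_b(χ_{d,ℓ}) = b ℓ² / p^{2d}`, as a function of the index `(d, ℓ)`. -/
noncomputable def psi (p : ℕ) (b : ℝ≥0) (d : ℕ) (l : ℤ) : ℝ :=
  (b : ℝ) * (l : ℝ) ^ 2 / (p : ℝ) ^ (2 * d)

/-- `γ` has Fourier transform `exp (-ψ_b / 2)`. -/
def IsSymmetricGauss (p : ℕ) (b : ℝ≥0) (γ : ProbabilityMeasure (solenoid p)) : Prop :=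
  ∀ (d : ℕ) (l : ℤ),
    ∫ y, (chi p d l y : ℂ) ∂(γ : Measure (solenoid p)) = Complex.exp (-(psi p b d l : ℂ) / 2)

theorem coord_eq_pow (p : ℕ) (y : solenoid p) (d k : ℕ) :
    (y : ℕ → Circle) d = (y : ℕ → Circle) (d + k) ^ p ^ k := by
  induction k with
  | zero => simp
  | succ k ih =>
    rw [ih, y.2 (d + k), ← pow_mul, pow_succ', ← add_assoc]

/-- The bounded continuous functions on the solenoid given by characters form a monoid. -/
def charSubmonoid (p : ℕ) : Submonoid (solenoid p →ᵇ ℂ) where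
  carrier := {f | ∃ (d : ℕ) (l : ℤ), ∀ y, f y = (chi p d l y : ℂ)}
  one_mem' := ⟨0, 0, fun y => by simp⟩
  mul_mem' := by
    rintro f g ⟨d, l, hf⟩ ⟨d', l', hg⟩
    refine ⟨d + d', l * (p : ℤ) ^ d' + l' * (p : ℤ) ^ d, fun y => ?_⟩
    have h1 := coord_eq_pow p y d d'
    have h2 := coord_eq_pow p y d' d
    rw [add_comm d' d] at h2
    simp only [BoundedContinuousFunction.mul_apply, hf, hg, chi_apply]
    rw [← Circle.coe_mul, h1, h2, zpow_add]
    congr 2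
    · rw [← zpow_natCast, ← zpow_mul]; push_cast; ring_nf
    · rw [← zpow_natCast, ← zpow_mul]; push_cast; ring_nf

instance instPolishSpace (p : ℕ) : PolishSpace (solenoid p) := by
  have : PolishSpace Circle := inferInstance
  exact (isClosed p).polishSpace

theorem continuous_chi (p d : ℕ) (l : ℤ) : Continuous fun y => (chi p d l y : ℂ) :=
  continuous_subtype_val.comp (map_continuous (chi p d l))

/-- A probability measure on the solenoid is determined by the integrals of the characters
`χ_{d,ℓ}`. -/
theorem ext_of_integral_chi (p : ℕ) (μ ν : Measure (solenoid p))
    [IsProbabilityMeasure μ] [IsProbabilityMeasure ν] (h : ∀ (d : ℕ) (l : ℤ), ∫ y, (chi p d l y : ℂ) ∂μ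
      = ∫ y, (chi p d l y : ℂ) ∂ν) : μ = ν := by
  let A : StarSubalgebra ℂ (solenoid p →ᵇ ℂ) :=
    StarAlgebra.adjoin ℂ (charSubmonoid p : Set (solenoid p →ᵇ ℂ))
  have hstar : star (charSubmonoid p : Set (solenoid p →ᵇ ℂ)) ⊆ charSubmonoid p := by
    rintro f ⟨d, l, hf⟩
    refine ⟨d, -l, fun y => ?_⟩
    have h1 := congrArg star (hf y)
    simp only [BoundedContinuousFunction.star_apply, star_star] at h1
    rw [h1]
    simp only [chi_apply, zpow_neg, Circle.coe_inv_eq_conj]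
    rfl
  have hA : A.toSubalgebra.toSubmodule
      = Submodule.span ℂ (charSubmonoid p : Set (solenoid p →ᵇ ℂ)) := by
    rw [StarAlgebra.adjoin_toSubalgebra, Set.union_eq_self_of_subset_right hstar,
      Algebra.adjoin_eq_span, Submonoid.closure_eq]
  have hsep : (A.map (BoundedContinuousFunction.toContinuousMapStarₐ ℂ)).SeparatesPoints := by
    intro x y hxy
    obtain ⟨d, hd⟩ : ∃ d, (x : ℕ → Circle) d ≠ (y : ℕ → Circle) d := by
      by_contra! hcon
      exact hxy (Subtype.ext (funext hcon))
    let f : solenoid p →ᵇ ℂ := BoundedContinuousFunction.mkOfCompact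
      ⟨fun z => ((z : ℕ → Circle) d : ℂ),
        continuous_subtype_val.comp ((continuous_apply d).comp continuous_subtype_val)⟩
    have hf : f ∈ A := StarAlgebra.subset_adjoin ℂ _ ⟨d, 1, fun z => by simp [f]⟩
    refine ⟨fun z => f z, ⟨BoundedContinuousFunction.toContinuousMapStarₐ ℂ f, ?_, rfl⟩, ?_⟩
    · exact ⟨f, hf, rfl⟩
    · intro hc
      exact hd (Circle.ext hc)
  have hint : ∀ g ∈ Submodule.span ℂ (charSubmonoid p : Set (solenoid p →ᵇ ℂ)),
      ∫ y, g y ∂μ = ∫ y, g y ∂ν := by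
   intro g hg
   induction hg using Submodule.span_induction with
   | mem f hf =>
     obtain ⟨d, l, hf⟩ := hf
     simp only [hf]
     exact h d l
   | zero => simp
   | add f g _ _ hf hg =>
     simp only [BoundedContinuousFunction.add_apply]
     rw [integral_add (f.integrable _) (g.integrable _),
       integral_add (f.integrable _) (g.integrable _), hf, hg]
   | smul c f _ hf =>
     simp only [BoundedContinuousFunction.smul_apply, integral_const_mul, smul_eq_mul, hf]
  refine ext_of_forall_mem_subalgebra_integral_eq_of_polish (𝕜 := ℂ) hsep fun g hg => hint g ?_
  rw [← hA]
  exact hg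

/-- The one-parameter subgroup `t ↦ (e^{it}, e^{it/p}, e^{it/p²}, …)`. -/
noncomputable def wind (p : ℕ) [Fact p.Prime] (t : ℝ) : solenoid p :=
  ⟨fun j => Circle.exp (t / (p : ℝ) ^ j), fun j => by
    have hp : (p : ℝ) ≠ 0 := Nat.cast_ne_zero.mpr (Fact.out : p.Prime).ne_zero
    rw [← Circle.exp_nsmul, nsmul_eq_mul, pow_succ]
    field_simp⟩

theorem continuous_wind (p : ℕ) [Fact p.Prime] : Continuous (wind p) := by
  unfold wind
  fun_prop

/-- There is exactly one probability measure with Fourier transform `exp (-ψ_b / 2)`. -/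
theorem existsUnique_isSymmetricGauss (p : ℕ) [Fact p.Prime] (b : ℝ≥0) :
    ∃! γ : ProbabilityMeasure (solenoid p), IsSymmetricGauss p b γ := by
  have hm : AEMeasurable (wind p) (gaussianReal 0 b) :=
    (continuous_wind p).measurable.aemeasurable
  have hex : IsSymmetricGauss p b
      ⟨(gaussianReal 0 b).map (wind p), Measure.isProbabilityMeasure_map hm⟩ := by
    intro d l
    have hc := charFun_gaussianReal (μ := 0) (v := b) ((l : ℝ) / (p : ℝ) ^ d)
    rw [charFun_apply_real] at hc
    simp only [ProbabilityMeasure.coe_mk]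
    rw [integral_map hm (continuous_chi p d l).aestronglyMeasurable]
    have he : ∀ t : ℝ, (chi p d l (wind p t) : ℂ)
        = Complex.exp (((l : ℝ) / (p : ℝ) ^ d : ℝ) * t * Complex.I) := by
      intro t
      simp only [chi_apply, wind]
      rw [← Circle.exp_zsmul, Circle.coe_exp]
      congr 2
      push_cast [zsmul_eq_mul]
      ring
    simp only [he]
    rw [hc]
    congr 1
    simp only [psi]
    push_cast
    ring
  exact ⟨_, hex, fun ν hν => Subtype.ext <|
    have : IsProbabilityMeasure (ν : Measure (solenoid p)) := ν.2
    have := Measure.isProbabilityMeasure_map hm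
    ext_of_integral_chi p ν _ fun d l => (hν d l).trans (hex d l).symm⟩

/-- The symmetric Gauss measure `γ_{ψ_b}`: the unique probability measure on the solenoid whose
Fourier transform is `exp (-ψ_b / 2)`. -/
noncomputable def gaussMeasure (p : ℕ) [Fact p.Prime] (b : ℝ≥0) :
    ProbabilityMeasure (solenoid p) :=
  (existsUnique_isSymmetricGauss p b).choose

theorem gaussMeasure_spec (p : ℕ) [Fact p.Prime] (b : ℝ≥0) :
    IsSymmetricGauss p b (gaussMeasure p b) :=
  (existsUnique_isSymmetricGauss p b).choose_spec.1

/-- The Haar measure `ω_{S_p}`, normalized by `ω_{S_p}(S_p) = 1`. -/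
noncomputable def omega (p : ℕ) : ProbabilityMeasure (solenoid p) :=
  ⟨Measure.haarMeasure ⊤, ⟨by
    simpa using Measure.haarMeasure_self (K₀ := (⊤ : TopologicalSpace.PositiveCompacts
      (solenoid p)))⟩⟩

end solenoid

/-- Infinitesimality of an array `X n k`, `k < K n`, of random elements of a group `G`, the `n`-th
row living on a probability space `(Ω n, P n)`:
`max_k P (X_{n,k} ∈ G ∖ U) → 0` for all Borel neighbourhoods `U` of the identity. -/
def IsInfinitesimalArray {G : Type*} [Group G] [TopologicalSpace G] [MeasurableSpace G]
    {Ω : ℕ → Type*} [∀ n, MeasurableSpace (Ω n)] (P : ∀ n, Measure (Ω n))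
    {K : ℕ → ℕ} (X : ∀ n, Fin (K n) → Ω n → G) : Prop :=
  ∀ U : Set G, MeasurableSet U → U ∈ 𝓝 (1 : G) →
    Tendsto (fun n => ⨆ k : Fin (K n), P n {ω | X n k ω ∉ U}) atTop (𝓝 0)

/-! The proof is Fourier analysis. By independence the row sum has transform `cos (l * arg x_d) ^ K
n` at χ_{d,l}. As x⁽ⁿ⁾ → e, eventually arg x_d = arg x_0 / p^d exactly (`eventually_arg_eq`), and
-log cos u ~ u²/2. So the transform behaves like exp(-(l²/p^{2d}) K_n (arg x_0)²/2), and the single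
sequence K_n (arg x_0)² governs every character. Its limit b yields exp(-ψ_b/2); its divergence
yields 0 at each l ≠ 0, the transform of Haar measure. Conversely, the character χ_{0,1} alone
recovers the condition. Pointwise convergence of transforms is equivalent to weak convergence
because the solenoid is compact and the χ_{d,l} separate measures
(`tendsto_iff_forall_integral_chi`). -/

/-! ### Asymptotics of powers of cosines -/

theorem Real.neg_log_cos_isEquivalent :
    Asymptotics.IsEquivalent (𝓝 0) (fun u : ℝ => -Real.log (Real.cos u)) fun u => u ^ 2 / 2 := by
  have hlog : Asymptotics.IsEquivalent (𝓝 1) Real.log fun v => v - 1 := by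
    simpa [Asymptotics.IsEquivalent, Pi.sub_def] using
      (Real.hasDerivAt_log (one_ne_zero : (1 : ℝ) ≠ 0)).isLittleO
  have hcos : Tendsto Real.cos (𝓝 0) (𝓝 1) := by
    simpa using Real.continuous_cos.tendsto 0
  have hhalf : Tendsto (fun u : ℝ => u / 2) (𝓝 0) (𝓝 0) := by
    simpa using (continuous_id.div_const (2 : ℝ)).tendsto 0
  -- Uses 1 - cos u = 2 sin²(u/2), hence the half-angle and the factor 2.
  have hsin := ((Real.isEquivalent_sin.comp_tendsto hhalf).pow 2).smul
    (Asymptotics.IsEquivalent.refl (u := fun _ : ℝ => (2 : ℝ)))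
  refine (hlog.comp_tendsto hcos).neg.trans ?_
  convert hsin using 1
  · funext u
    have h := Real.cos_two_mul (u / 2)
    have h' := Real.sin_sq_add_cos_sq (u / 2)
    rw [mul_div_cancel₀ _ two_ne_zero] at h
    simp only [Function.comp_apply, Pi.pow_apply, smul_eq_mul, h]
    linarith
  · funext u
    simp only [Function.comp_apply, Pi.pow_apply, smul_eq_mul, id]
    ring

section CosPow

variable {u : ℕ → ℝ} {K : ℕ → ℕ}

theorem mul_neg_log_cos_isEquivalent (hu : Tendsto u atTop (𝓝 0)) :
    Asymptotics.IsEquivalent atTop (fun n => (K n : ℝ) * -Real.log (Real.cos (u n)))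
      fun n => (K n : ℝ) * u n ^ 2 / 2 := by
  have h := (Asymptotics.IsEquivalent.refl (u := fun n => (K n : ℝ)) (l := atTop)).smul
    (Real.neg_log_cos_isEquivalent.comp_tendsto hu)
  simpa only [smul_eq_mul, Function.comp_apply, mul_div_assoc] using h

/-- The cosine may be nonpositive for small n; only once it is positive does its logarithm recover
it. -/
theorem cos_pow_eventuallyEq_exp (hu : Tendsto u atTop (𝓝 0)) :
    (fun n => Real.cos (u n) ^ K n) =ᶠ[atTop]
      fun n => Real.exp (-((K n : ℝ) * -Real.log (Real.cos (u n)))) := by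
  have hcos : Tendsto (fun n => Real.cos (u n)) atTop (𝓝 1) := by
    simpa [Function.comp_def] using (Real.continuous_cos.tendsto 0).comp hu
  filter_upwards [hcos.eventually (lt_mem_nhds one_pos)] with n hn
  rw [mul_neg, neg_neg, Real.exp_nat_mul, Real.exp_log hn]

theorem tendsto_cos_pow_exp_iff (hu : Tendsto u atTop (𝓝 0)) (b : ℝ) :
    Tendsto (fun n => Real.cos (u n) ^ K n) atTop (𝓝 (Real.exp (-b / 2))) ↔
      Tendsto (fun n => (K n : ℝ) * u n ^ 2) atTop (𝓝 b) := by
  rw [tendsto_congr' (cos_pow_eventuallyEq_exp hu)]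
  have hexp : Tendsto (fun n => Real.exp (-((K n : ℝ) * -Real.log (Real.cos (u n))))) atTop
      (𝓝 (Real.exp (-b / 2))) ↔
      Tendsto (fun n => (K n : ℝ) * -Real.log (Real.cos (u n))) atTop (𝓝 (b / 2)) := by
    constructor
    · intro h
      have h' := ((Real.continuousAt_log (Real.exp_ne_zero _)).tendsto.comp h).neg
      simpa [Function.comp_def, neg_div] using h'
    · intro h
      rw [neg_div]
      exact (Real.continuous_exp.tendsto _).comp h.neg
  rw [hexp, (mul_neg_log_cos_isEquivalent hu).tendsto_nhds_iff]
  constructor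
  · intro h
    simpa using h.mul_const 2
  · intro h
    exact h.div_const 2

theorem tendsto_cos_pow_zero_iff (hu : Tendsto u atTop (𝓝 0)) :
    Tendsto (fun n => Real.cos (u n) ^ K n) atTop (𝓝 0) ↔
      Tendsto (fun n => (K n : ℝ) * u n ^ 2) atTop atTop := by
  rw [tendsto_congr' (cos_pow_eventuallyEq_exp hu), Real.tendsto_exp_comp_nhds_zero,
    tendsto_neg_atBot_iff, (mul_neg_log_cos_isEquivalent hu).tendsto_atTop_iff,
    tendsto_div_const_atTop_of_pos two_pos]

end CosPow

/-- Once both atoms lie in U the probabilities vanish exactly, so the row lengths play no role. -/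
theorem isInfinitesimalArray_of_map_eq_dirac_add_dirac_inv {G : Type*} [Group G]
    [TopologicalSpace G] [ContinuousInv G] [MeasurableSpace G]
    {x : ℕ → G} (hx : Tendsto x atTop (𝓝 1)) {K : ℕ → ℕ}
    {Ω : ℕ → Type*} [∀ n, MeasurableSpace (Ω n)] {P : ∀ n, Measure (Ω n)}
    {X : ∀ n, Fin (K n) → Ω n → G} (hmeas : ∀ n k, Measurable (X n k))
    (hlaw : ∀ n k, (P n).map (X n k) =
      (1 / 2 : ℝ≥0∞) • Measure.dirac (x n) + (1 / 2 : ℝ≥0∞) • Measure.dirac (x n)⁻¹) :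
    IsInfinitesimalArray P X := by
  intro U hU hU1
  have hx' : Tendsto (fun n => (x n)⁻¹) atTop (𝓝 1) := by simpa using hx.inv
  refine tendsto_const_nhds.congr' ?_
  filter_upwards [hx hU1, hx' hU1] with n h1 h2
  symm
  refine le_antisymm (iSup_le fun k => ?_) bot_le
  have h := congrArg (fun m => m Uᶜ) (hlaw n k)
  simp only [Measure.map_apply (hmeas n k) hU.compl, Measure.add_apply, Measure.smul_apply,
    Measure.dirac_apply' _ hU.compl] at h
  rw [Set.indicator_of_notMem (by simpa using h1),
    Set.indicator_of_notMem (by simpa using h2)] at h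
  have h0 : P n (X n k ⁻¹' Uᶜ) = 0 := by simpa using h
  exact h0.le

/-! ### Fourier analysis on the solenoid -/

namespace solenoid

/-- Tightness is automatic: probability measures on a compact space form a compact space, so each
ultrafilter has a limit, and its character integrals identify it as `μ₀`. -/
theorem tendsto_iff_forall_integral_chi (p : ℕ) {ι : Type*} {F : Filter ι}
    {μ : ι → ProbabilityMeasure (solenoid p)} {μ₀ : ProbabilityMeasure (solenoid p)} :
    Tendsto μ F (𝓝 μ₀) ↔ ∀ (d : ℕ) (l : ℤ),
      Tendsto (fun i => ∫ y, (chi p d l y : ℂ) ∂(μ i : Measure (solenoid p))) F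
        (𝓝 (∫ y, (chi p d l y : ℂ) ∂(μ₀ : Measure (solenoid p)))) := by
  -- Stated for any filter, since it serves both `F` and the ultrafilter `V`.
  have key {κ : Type _} {H : Filter κ} {m : κ → ProbabilityMeasure (solenoid p)}
      {m₀ : ProbabilityMeasure (solenoid p)} (h : Tendsto m H (𝓝 m₀)) (d : ℕ) (l : ℤ) :
      Tendsto (fun i => ∫ y, (chi p d l y : ℂ) ∂(m i : Measure (solenoid p))) H
        (𝓝 (∫ y, (chi p d l y : ℂ) ∂(m₀ : Measure (solenoid p)))) :=
    (ProbabilityMeasure.tendsto_iff_forall_integral_rclike_tendsto ℂ).1 h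
      (BoundedContinuousFunction.mkOfCompact ⟨_, continuous_chi p d l⟩)
  refine ⟨key, fun h => (tendsto_iff_ultrafilter _ _ _).2 fun V hV => ?_⟩
  obtain ⟨ν, -, hν⟩ := isCompact_univ.ultrafilter_le_nhds (V.map μ) (by simp)
  have hν' : Tendsto μ V (𝓝 ν) := hν
  have heq : (ν : Measure (solenoid p)) = μ₀ := ext_of_integral_chi p _ _ fun d l =>
    tendsto_nhds_unique (key hν' d l) ((h d l).mono_left hV)
  have : ν = μ₀ := Subtype.ext heq
  exact this ▸ hν'

theorem tendstoInDistribution_iff_integral_chi (p : ℕ) {ι : Type*} {F : Filter ι}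
    {Ω : ι → Type*} [∀ n, MeasurableSpace (Ω n)]
    {P : ∀ n, Measure (Ω n)} [∀ n, IsProbabilityMeasure (P n)]
    {S : ∀ n, Ω n → solenoid p} (hS : ∀ n, Measurable (S n))
    (μ : ProbabilityMeasure (solenoid p)) :
    TendstoInDistribution S F id P (μ : Measure (solenoid p)) ↔ ∀ (d : ℕ) (l : ℤ),
      Tendsto (fun n => ∫ ω, (chi p d l (S n ω) : ℂ) ∂P n) F
        (𝓝 (∫ y, (chi p d l y : ℂ) ∂(μ : Measure (solenoid p)))) := by
  have hmap (n : ι) (d : ℕ) (l : ℤ) :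
      ∫ y, (chi p d l y : ℂ) ∂(P n).map (S n) = ∫ ω, (chi p d l (S n ω) : ℂ) ∂P n :=
    integral_map (hS n).aemeasurable (continuous_chi p d l).aestronglyMeasurable
  constructor
  · intro h d l
    have h' := (tendsto_iff_forall_integral_chi p).1 h.tendsto d l
    simpa only [ProbabilityMeasure.coe_mk, hmap, Measure.map_id] using h'
  · intro h
    refine ⟨fun n => (hS n).aemeasurable, aemeasurable_id, ?_⟩
    refine (tendsto_iff_forall_integral_chi p).2 fun d l => ?_
    simpa only [ProbabilityMeasure.coe_mk, hmap, Measure.map_id] using h d l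

theorem integral_chi_dirac_add_dirac_inv (p d : ℕ) (l : ℤ) (x : solenoid p) :
    ∫ y, (chi p d l y : ℂ)
        ∂((1 / 2 : ℝ≥0∞) • Measure.dirac x + (1 / 2 : ℝ≥0∞) • Measure.dirac x⁻¹) =
      (Real.cos (l * ((x : ℕ → Circle) d : ℂ).arg) : ℂ) := by
  have hint (y : solenoid p) :
      Integrable (fun y => (chi p d l y : ℂ)) ((1 / 2 : ℝ≥0∞) • Measure.dirac y) :=
    ((BoundedContinuousFunction.mkOfCompact ⟨_, continuous_chi p d l⟩).integrable
      (Measure.dirac y)).smul_measure (by simp)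
  have hchi : chi p d l x = Circle.exp (l * ((x : ℕ → Circle) d : ℂ).arg) := by
    rw [← zsmul_eq_mul, Circle.exp_zsmul, Circle.exp_arg, chi_apply]
  rw [integral_add_measure (hint _) (hint _), integral_smul_measure, integral_smul_measure,
    integral_dirac, integral_dirac, map_inv, hchi, ← Circle.exp_neg, Circle.coe_exp,
    Circle.coe_exp, Complex.ofReal_cos, Complex.cos]
  simp only [one_div, ENNReal.toReal_inv, ENNReal.toReal_ofNat, Complex.real_smul]
  push_cast
  ring_nf

theorem integral_chi_prod (p d : ℕ) (l : ℤ) (x : solenoid p)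
    {ι Ω : Type*} [Fintype ι] [MeasurableSpace Ω] {P : Measure Ω}
    {X : ι → Ω → solenoid p} (hmeas : ∀ k, Measurable (X k)) (hindep : iIndepFun X P)
    (hlaw : ∀ k, P.map (X k) =
      (1 / 2 : ℝ≥0∞) • Measure.dirac x + (1 / 2 : ℝ≥0∞) • Measure.dirac x⁻¹) :
    ∫ ω, (chi p d l (∏ k, X k ω) : ℂ) ∂P =
      ((Real.cos (l * ((x : ℕ → Circle) d : ℂ).arg) ^ Fintype.card ι : ℝ) : ℂ) := by
  have hprod (ω : Ω) : (chi p d l (∏ k, X k ω) : ℂ) = ∏ k, (chi p d l (X k ω) : ℂ) := by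
    rw [map_prod]
    exact map_prod Circle.coeHom _ _
  simp only [hprod]
  rw [hindep.integral_fun_prod_comp (f := fun _ y => (chi p d l y : ℂ))
    (fun k => (hmeas k).aemeasurable) fun k => (continuous_chi p d l).aestronglyMeasurable]
  have hk (k : ι) : ∫ ω, (chi p d l (X k ω) : ℂ) ∂P =
      (Real.cos (l * ((x : ℕ → Circle) d : ℂ).arg) : ℂ) := by
    rw [← integral_chi_dirac_add_dirac_inv, ← hlaw k]
    exact (integral_map (hmeas k).aemeasurable
      (continuous_chi p d l).aestronglyMeasurable).symm
  rw [Finset.prod_congr rfl fun k _ => hk k, Finset.prod_const, Finset.card_univ,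
    Complex.ofReal_pow]

theorem exists_chi_ne_one (p : ℕ) [Fact p.Prime] (d : ℕ) {l : ℤ} (hl : l ≠ 0) :
    ∃ y, (chi p d l y : ℂ) ≠ 1 := by
  have hp : (p : ℝ) ≠ 0 := Nat.cast_ne_zero.mpr (Fact.out : p.Prime).ne_zero
  have hl' : (l : ℝ) ≠ 0 := Int.cast_ne_zero.mpr hl
  -- The parameter is chosen so that the character takes the value e^{iπ} = -1.
  refine ⟨wind p ((p : ℝ) ^ d * Real.pi / l), ?_⟩
  have h : chi p d l (wind p ((p : ℝ) ^ d * Real.pi / l)) = Circle.exp Real.pi := by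
    simp only [chi_apply, wind]
    rw [← Circle.exp_zsmul, zsmul_eq_mul]
    congr 1
    field_simp
  rw [h, Circle.coe_exp, Complex.exp_pi_mul_I]
  norm_num

/-- Translation by `g` preserves the integral but multiplies it by χ(g) ≠ 1. -/
theorem integral_chi_omega (p : ℕ) [Fact p.Prime] (d : ℕ) {l : ℤ} (hl : l ≠ 0) :
    ∫ y, (chi p d l y : ℂ) ∂(omega p : Measure (solenoid p)) = 0 := by
  obtain ⟨g, hg⟩ := exists_chi_ne_one p d hl
  have h := integral_mul_left_eq_self (μ := Measure.haarMeasure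
    (⊤ : TopologicalSpace.PositiveCompacts (solenoid p))) (fun y => (chi p d l y : ℂ)) g
  simp only [map_mul, Circle.coe_mul, integral_const_mul] at h
  by_contra hne
  exact hg (mul_right_cancel₀ hne (h.trans (one_mul _).symm))

theorem tendsto_arg (p d : ℕ) {x : ℕ → solenoid p} (hx : Tendsto x atTop (𝓝 1)) :
    Tendsto (fun n => ((x n : ℕ → Circle) d : ℂ).arg) atTop (𝓝 0) := by
  have hc : Tendsto (fun n => ((x n : ℕ → Circle) d : ℂ)) atTop (𝓝 1) := by
    have h : Continuous fun y : solenoid p => ((y : ℕ → Circle) d : ℂ) :=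
      continuous_subtype_val.comp ((continuous_apply d).comp continuous_subtype_val)
    simpa [Function.comp_def] using (h.tendsto 1).comp hx
  simpa [Function.comp_def] using
    (Complex.continuousAt_arg Complex.one_mem_slitPlane).tendsto.comp hc

/-- Since x_0 = x_d^{p^d}, the arguments agree up to a multiple of 2π, which vanishes once p^d |arg
x_d| < π. -/
theorem eventually_arg_eq (p : ℕ) [Fact p.Prime] (d : ℕ) {x : ℕ → solenoid p}
    (hx : Tendsto x atTop (𝓝 1)) :
    ∀ᶠ n in atTop, ((x n : ℕ → Circle) d : ℂ).arg =
      ((x n : ℕ → Circle) 0 : ℂ).arg / (p : ℝ) ^ d := by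
  have hp : (p : ℝ) ≠ 0 := Nat.cast_ne_zero.mpr (Fact.out : p.Prime).ne_zero
  have h := (tendsto_arg p d hx).const_mul ((p : ℝ) ^ d)
  rw [mul_zero] at h
  filter_upwards [h.eventually (Ioo_mem_nhds (neg_lt_zero.2 Real.pi_pos) Real.pi_pos)] with n hn
  have h0 : (x n : ℕ → Circle) 0 =
      Circle.exp ((p : ℝ) ^ d * ((x n : ℕ → Circle) d : ℂ).arg) := by
    rw [coord_eq_pow p (x n) 0 d, ← Nat.cast_pow, ← nsmul_eq_mul, Circle.exp_nsmul,
      Circle.exp_arg, zero_add]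
  rw [h0, Circle.arg_exp hn.1 hn.2.le, mul_div_cancel_left₀ _ (pow_ne_zero d hp)]

end solenoid

/-! ### The limit theorem -/

theorem mainTheorem12 (p : ℕ) [Fact p.Prime]
    (x : ℕ → solenoid p) (hx : Tendsto x atTop (𝓝 1))
    (K : ℕ → ℕ) (hK : Tendsto K atTop atTop)
    {Ω : ℕ → Type*} [∀ n, MeasurableSpace (Ω n)]
    (P : ∀ n, Measure (Ω n)) [∀ n, IsProbabilityMeasure (P n)]
    (X : ∀ n, Fin (K n) → Ω n → solenoid p)
    (hmeas : ∀ n k, Measurable (X n k))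
    (hindep : ∀ n, iIndepFun (X n) (P n))
    (hlaw : ∀ n k, (P n).map (X n k) =
      (1 / 2 : ℝ≥0∞) • Measure.dirac (x n) + (1 / 2 : ℝ≥0∞) • Measure.dirac (x n)⁻¹) :
    IsInfinitesimalArray P X ∧
    (∀ b : ℝ≥0,
      TendstoInDistribution (fun n ω => ∏ k, X n k ω) atTop id P
          (solenoid.gaussMeasure p b : Measure (solenoid p)) ↔
        Tendsto (fun n => (K n : ℝ) * (((x n : ℕ → Circle) 0 : ℂ).arg) ^ 2) atTop
          (𝓝 (b : ℝ))) ∧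
    (TendstoInDistribution (fun n ω => ∏ k, X n k ω) atTop id P
          (solenoid.omega p : Measure (solenoid p)) ↔
        Tendsto (fun n => (K n : ℝ) * (((x n : ℕ → Circle) 0 : ℂ).arg) ^ 2) atTop atTop) := by
  have hS (n : ℕ) : Measurable fun ω => ∏ k, X n k ω :=
    Finset.measurable_fun_prod _ fun k _ => hmeas n k
  have hF (d : ℕ) (l : ℤ) (n : ℕ) : ∫ ω, (solenoid.chi p d l (∏ k, X n k ω) : ℂ) ∂P n =
      ((Real.cos (l * ((x n : ℕ → Circle) d : ℂ).arg) ^ K n : ℝ) : ℂ) := by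
    simpa using solenoid.integral_chi_prod p d l (x n) (hmeas n) (hindep n) (hlaw n)
  have hu (d : ℕ) (l : ℤ) :
      Tendsto (fun n => l * ((x n : ℕ → Circle) d : ℂ).arg) atTop (𝓝 0) := by
    simpa using (solenoid.tendsto_arg p d hx).const_mul (l : ℝ)
  have hscale (d : ℕ) (l : ℤ) :
      (fun n => (K n : ℝ) * (l * ((x n : ℕ → Circle) d : ℂ).arg) ^ 2) =ᶠ[atTop]
        fun n => (l : ℝ) ^ 2 / (p : ℝ) ^ (2 * d) *
          ((K n : ℝ) * ((x n : ℕ → Circle) 0 : ℂ).arg ^ 2) := by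
    filter_upwards [solenoid.eventually_arg_eq p d hx] with n hn
    rw [hn, pow_mul', mul_pow, div_pow]
    ring
  have hp : (0 : ℝ) < p := Nat.cast_pos.2 (Fact.out : p.Prime).pos
  refine ⟨isInfinitesimalArray_of_map_eq_dirac_add_dirac_inv hx hmeas hlaw, fun b => ?_, ?_⟩
  · have hγ (d : ℕ) (l : ℤ) : ∫ y, (solenoid.chi p d l y : ℂ)
        ∂(solenoid.gaussMeasure p b : Measure (solenoid p)) =
        (Real.exp (-solenoid.psi p b d l / 2) : ℂ) := by
      rw [solenoid.gaussMeasure_spec p b d l]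
      push_cast
      rfl
    rw [solenoid.tendstoInDistribution_iff_integral_chi p hS]
    simp only [hF, hγ, tendsto_ofReal_iff, tendsto_cos_pow_exp_iff (hu _ _)]
    constructor
    · intro h
      -- At (d, l) = (0, 1) the value of ψ_b is b itself.
      simpa [solenoid.psi] using h 0 1
    · intro h d l
      rw [tendsto_congr' (hscale d l)]
      convert h.const_mul ((l : ℝ) ^ 2 / (p : ℝ) ^ (2 * d)) using 2
      simp only [solenoid.psi]
      ring
  · rw [solenoid.tendstoInDistribution_iff_integral_chi p hS]
    simp only [hF]
    constructor
    · intro h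
      have h1 := h 0 1
      rw [solenoid.integral_chi_omega p 0 one_ne_zero, ← Complex.ofReal_zero,
        tendsto_ofReal_iff, tendsto_cos_pow_zero_iff (hu _ _)] at h1
      simpa using h1
    · intro h d l
      rcases eq_or_ne l 0 with rfl | hl
      -- The trivial character integrates to 1 on both sides.
      · simp
      · rw [solenoid.integral_chi_omega p d hl, ← Complex.ofReal_zero,
          tendsto_ofReal_iff, tendsto_cos_pow_zero_iff (hu _ _),
          tendsto_congr' (hscale d l)]
        have hl' : (l : ℝ) ≠ 0 := Int.cast_ne_zero.2 hl
        exact h.const_mul_atTop (by positivity)
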